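/- Let $d,n\ge 1$ be integers, let $A:\mathbb R^d\to\mathbb R^d$ and $B:\mathbb R^n\to\mathbb R^d$ be linear maps, let $F:\mathbb R^d\to\mathbb R^d$ be smooth and globally Lipschitz, and let $(W_t)_{t\ge 0}$ be a Wiener process in $\mathbb R^n$ on a probability space $(\Omega,\mathcal F,\mathbf P)$. For $x\in\mathbb R^d$ let $(X_t(x))_{t\ge 0}$ be the (unique) continuous solution of $$X_t(x)=x+\int_0^t \big(A X_s(x)+F(X_s(x))\big)\,ds+B W_t ,\qquad t\ge 0,$$ and let $P_T(x,\cdot)$ denote the distribution of the random variable $X_T(x)$. Suppose that: (K) the columns of $B, AB, A^2B,\dots$ span $\mathbb R^d$; let $d_*$ be an integer such that already $\operatorname{span}\{A^kBe_i : 0\le k<d_*,\ 1\le i\le n\}=\mathbb R^d$, where $e_1,\dots,e_n$ is the standard basis of $\mathbb R^n$; (G) there is $a\in[0,\tfrac1{2d_*})$ such that $\displaystyle\sup_{x\in\mathbb R^d}\frac{|F(x)|}{(1+|x|)^a}<\infty$. Then, for every $x_0\in\mathbb R^d$ and $\delta>0$, with $B(x_0,\delta)$ the open Euclidean ball of radius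 $\delta$ centred at $x_0$, the function $$(x,T)\mapsto P_T(x,B(x_0,\delta))$$ is strictly positive on $\mathbb R^d\times(0,\infty)$ and jointly lower semicontinuous on $\mathbb R^d\times[0,\infty)$. -/

import Mathlib

open MeasureTheory ProbabilityTheory
open scoped NNReal ENNReal

namespace LangevinSDE

section Integral

variable {E : Type*} [NormedAddCommGroup E] [NormedSpace ℝ E] [CompleteSpace E]

/-- A Volterra equation with globally Lipschitz `G` and continuous forcing `w` has a continuous
solution on `[0, ∞)`. -/
theorem exists_volterra {K : ℝ≥0} {G : E → E} (hG : LipschitzWith K G) {w : ℝ≥0 → E}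
    (hw : Continuous w) :
    ∃ y : ℝ≥0 → E, Continuous y ∧
      ∀ t : ℝ≥0, y t = w t + ∫ s in (0 : ℝ)..t, G (y s.toNNReal) := by
  have hGc := hG.continuous
  set g : ℝ → ℝ := fun s => ‖G (w s.toNNReal)‖ with hg
  have hgc : Continuous g := by fun_prop
  set l : ℝ := 2 * K + 1 with hl
  have hl0 : 0 < l := by positivity
  set q : ℝ → ℝ := fun t => 1 + ∫ s in (0 : ℝ)..t, g s with hq
  have hqc : Continuous q :=
    continuous_const.add (intervalIntegral.continuous_primitive
      (fun a b => hgc.intervalIntegrable a b) 0)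
  have hq1 : ∀ t, 0 ≤ t → 1 ≤ q t := fun t ht => by
    have : 0 ≤ ∫ s in (0 : ℝ)..t, g s :=
      intervalIntegral.integral_nonneg ht fun s _ => norm_nonneg _
    simp only [hq]; linarith
  have hqm : ∀ s t, 0 ≤ s → s ≤ t → q s ≤ q t := fun s t hs hst => by
    have h1 := intervalIntegral.integral_add_adjacent_intervals
      (hgc.intervalIntegrable (μ := volume) 0 s) (hgc.intervalIntegrable s t)
    have : 0 ≤ ∫ u in s..t, g u :=
      intervalIntegral.integral_nonneg hst fun s _ => norm_nonneg _
    simp only [hq]; linarith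
  set p : ℝ → ℝ := fun t => Real.exp (l * t) * q t with hp
  have hpc : Continuous p := by fun_prop
  have hp1 : ∀ t, 0 ≤ t → 0 < p t := fun t ht =>
    mul_pos (Real.exp_pos _) (by linarith [hq1 t ht])
  have hqp : ∀ t, 0 ≤ t → q t ≤ p t := fun t ht => by
    have h1 : 1 ≤ Real.exp (l * t) := Real.one_le_exp (by positivity)
    have := hq1 t ht
    simp only [hp]; nlinarith
  have hpi : ∀ t, 0 ≤ t → ∫ s in (0 : ℝ)..t, p s ≤ p t / l := fun t ht => by
    have h1 : ∫ s in (0 : ℝ)..t, p s ≤ ∫ s in (0 : ℝ)..t, Real.exp (l * s) * q t := by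
      refine intervalIntegral.integral_mono_on ht (hpc.intervalIntegrable _ _)
        (Continuous.intervalIntegrable (by fun_prop) _ _) fun s hs => ?_
      exact mul_le_mul_of_nonneg_left (hqm s t hs.1 hs.2) (Real.exp_pos _).le
    have h2 : ∫ s in (0 : ℝ)..t, Real.exp (l * s) * q t
        = l⁻¹ * (Real.exp (l * t) - 1) * q t := by
      rw [intervalIntegral.integral_mul_const,
        intervalIntegral.integral_comp_mul_left (fun s => Real.exp s) hl0.ne']
      simp
    rw [h2] at h1
    refine h1.trans ?_
    rw [div_eq_inv_mul, mul_assoc]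
    refine mul_le_mul_of_nonneg_left ?_ (by positivity)
    have := hq1 t ht
    simp only [hp]; nlinarith
  -- integrand and Picard map for the rescaled unknown `u = (y - w) / p`
  let I : BoundedContinuousFunction ℝ≥0 E → ℝ → E :=
    fun u s => G (p s • u s.toNNReal + w s.toNNReal)
  have hIc : ∀ u, Continuous (I u) := fun u => by
    have := u.continuous
    simp only [I]; fun_prop
  let J : BoundedContinuousFunction ℝ≥0 E → ℝ≥0 → E :=
    fun u t => (p t)⁻¹ • ∫ s in (0 : ℝ)..t, I u s
  have hJc : ∀ u, Continuous (J u) := fun u => by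
    have h1 : Continuous fun b : ℝ => ∫ s in (0 : ℝ)..b, I u s :=
      intervalIntegral.continuous_primitive (fun a b => (hIc u).intervalIntegrable a b) 0
    have h2 : Continuous fun t : ℝ≥0 => (p t)⁻¹ :=
      (hpc.comp NNReal.continuous_coe).inv₀ fun t => (hp1 t t.2).ne'
    exact h2.smul (h1.comp NNReal.continuous_coe)
  have hdiff : ∀ u v (t : ℝ≥0), ‖J u t - J v t‖ ≤ (K / l) * ‖u - v‖ := fun u v t => by
    have hb : ‖∫ s in (0 : ℝ)..t, (I u s - I v s)‖
        ≤ ∫ s in (0 : ℝ)..t, p s * (K * ‖u - v‖) := by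
      refine intervalIntegral.norm_integral_le_of_norm_le t.2 (Filter.Eventually.of_forall ?_)
        (Continuous.intervalIntegrable (by fun_prop) _ _)
      intro s hs
      have h1 := hG.norm_sub_le (p s • u s.toNNReal + w s.toNNReal)
        (p s • v s.toNNReal + w s.toNNReal)
      have h2 := (u - v).norm_coe_le_norm s.toNNReal
      have h3 := hp1 s hs.1.le
      rw [add_sub_add_right_eq_sub, ← smul_sub, norm_smul, Real.norm_of_nonneg h3.le] at h1
      refine h1.trans ?_
      simp only [BoundedContinuousFunction.coe_sub, Pi.sub_apply] at h2
      calc (K : ℝ) * (p s * ‖u s.toNNReal - v s.toNNReal‖)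
          ≤ K * (p s * ‖u - v‖) := by gcongr
        _ = p s * (K * ‖u - v‖) := by ring
    rw [intervalIntegral.integral_mul_const] at hb
    have h3 := hp1 t t.2
    have h4 := hpi t t.2
    simp only [J]
    rw [← smul_sub, ← intervalIntegral.integral_sub ((hIc u).intervalIntegrable _ _)
      ((hIc v).intervalIntegrable _ _), norm_smul, norm_inv, Real.norm_of_nonneg h3.le]
    calc (p t)⁻¹ * ‖∫ s in (0 : ℝ)..t, (I u s - I v s)‖
        ≤ (p t)⁻¹ * (p t / l * (K * ‖u - v‖)) := by
          refine mul_le_mul_of_nonneg_left (hb.trans ?_) (by positivity)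
          gcongr
      _ = (K / l) * ‖u - v‖ := by field_simp
  have h0 : ∀ t : ℝ≥0, ‖J 0 t‖ ≤ 1 := fun t => by
    have h3 := hp1 t t.2
    have hb : ‖∫ s in (0 : ℝ)..t, I 0 s‖ ≤ ∫ s in (0 : ℝ)..t, g s := by
      refine intervalIntegral.norm_integral_le_of_norm_le t.2 (Filter.Eventually.of_forall ?_)
        (hgc.intervalIntegrable _ _)
      intro s hs
      simp [I, hg]
    have h4 := hqp t t.2
    simp only [J]
    rw [norm_smul, norm_inv, Real.norm_of_nonneg h3.le, inv_mul_le_iff₀ h3]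
    simp only [hq] at h4
    linarith
  let Φ : BoundedContinuousFunction ℝ≥0 E → BoundedContinuousFunction ℝ≥0 E := fun u =>
    BoundedContinuousFunction.ofNormedAddCommGroup (J u) (hJc u) ((K / l) * ‖u - 0‖ + 1)
      fun t => by
        have h1 := hdiff u 0 t
        have h2 := norm_le_norm_add_norm_sub' (J u t) (J 0 t)
        linarith [h0 t]
  have hKl : (K : ℝ) / l ≤ 1 / 2 := by
    rw [div_le_iff₀ hl0]; simp only [hl]; linarith
  have hΦ : ContractingWith (1 / 2) Φ := by
    refine ⟨by norm_num, LipschitzWith.of_dist_le_mul fun u v => ?_⟩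
    rw [BoundedContinuousFunction.dist_le (by positivity)]
    intro t
    rw [dist_eq_norm, dist_eq_norm]
    refine (hdiff u v t).trans ?_
    have : (((1 / 2 : ℝ≥0)) : ℝ) = 1 / 2 := by norm_num
    rw [this]
    gcongr
  obtain ⟨u, hu⟩ : ∃ u, Φ u = u := ⟨_, hΦ.fixedPoint_isFixedPt⟩
  have hu' : ∀ t, J u t = u t := fun t => by
    conv_rhs => rw [← hu]
    rfl
  refine ⟨fun t => p t • u t + w t, ?_, fun t => ?_⟩
  · have := u.continuous
    fun_prop
  · have h3 := hp1 t t.2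
    have h5 : p t • u t = ∫ s in (0 : ℝ)..t, I u s := by
      rw [← hu' t]; simp only [J]; rw [smul_inv_smul₀ h3.ne']
    change p t • u t + w t = _
    rw [add_comm, h5]
    congr 1
    refine intervalIntegral.integral_congr fun s hs => ?_
    rw [Set.uIcc_of_le (show (0 : ℝ) ≤ t from t.2)] at hs
    simp only [I, Real.coe_toNNReal s hs.1]

/-- Continuous solutions of such a Volterra equation are unique. -/
theorem unique_volterra {K : ℝ≥0} {G : E → E} (hG : LipschitzWith K G) {w : ℝ≥0 → E}
    {y z : ℝ≥0 → E} (hy : Continuous y) (hz : Continuous z)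
    (hy' : ∀ t : ℝ≥0, y t = w t + ∫ s in (0 : ℝ)..t, G (y s.toNNReal))
    (hz' : ∀ t : ℝ≥0, z t = w t + ∫ s in (0 : ℝ)..t, G (z s.toNNReal)) : y = z := by
  have hGc := hG.continuous
  have key : ∀ v : ℝ≥0 → E, Continuous v →
      (∀ t : ℝ≥0, v t = w t + ∫ s in (0 : ℝ)..t, G (v s.toNNReal)) → ∀ t : ℝ, 0 ≤ t →
      HasDerivAt (fun r : ℝ => ∫ s in (0 : ℝ)..r, G (v s.toNNReal))
        (G ((∫ s in (0 : ℝ)..t, G (v s.toNNReal)) + w t.toNNReal)) t := by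
    intro v hv hv' t ht
    have hc : Continuous fun s : ℝ => G (v s.toNNReal) := by fun_prop
    have h1 := intervalIntegral.integral_hasDerivAt_right (hc.intervalIntegrable 0 t)
      (hc.stronglyMeasurableAtFilter _ _) hc.continuousAt
    have h2 := hv' t.toNNReal
    rw [Real.coe_toNNReal t ht] at h2
    rw [h2, add_comm] at h1
    exact h1
  funext t
  have := ODE_solution_unique (v := fun (s : ℝ) e => G (e + w s.toNNReal)) (K := K)
    (f := fun r : ℝ => ∫ s in (0 : ℝ)..r, G (y s.toNNReal))
    (g := fun r : ℝ => ∫ s in (0 : ℝ)..r, G (z s.toNNReal)) (a := 0) (b := t)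
    (fun s => by
      intro a b
      simpa using hG (a + w s.toNNReal) (b + w s.toNNReal))
    (intervalIntegral.continuous_primitive
      (fun a b => Continuous.intervalIntegrable (by fun_prop) a b) 0).continuousOn
    (fun s hs => (key y hy hy' s hs.1).hasDerivWithinAt)
    (intervalIntegral.continuous_primitive
      (fun a b => Continuous.intervalIntegrable (by fun_prop) a b) 0).continuousOn
    (fun s hs => (key z hz hz' s hs.1).hasDerivWithinAt)
    (by simp) ⟨t.2, le_refl _⟩
  rw [hy' t, hz' t]
  exact congrArg _ this

end Integral

/-- `ℝ^d` with its Euclidean norm. -/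
abbrev Vec (d : ℕ) : Type := EuclideanSpace ℝ (Fin d)

/-- The span of the vectors `A ^ k (B e_i)`, `k < m`, where `e_i` is the standard basis. -/
noncomputable def kalmanSpan {d n : ℕ} (A : Vec d →L[ℝ] Vec d) (B : Vec n →L[ℝ] Vec d) (m : ℕ) :
    Submodule ℝ (Vec d) :=
  Submodule.span ℝ {v | ∃ k < m, ∃ i : Fin n, v = (A ^ k) (B (EuclideanSpace.single i 1))}

/-- Kalman condition: the columns of `B`, `A B`, `A² B`, … span `ℝ^d`. -/
def KalmanCondition {d n : ℕ} (A : Vec d →L[ℝ] Vec d) (B : Vec n →L[ℝ] Vec d) : Prop :=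
  Submodule.span ℝ {v | ∃ (k : ℕ) (i : Fin n), v = (A ^ k) (B (EuclideanSpace.single i 1))} = ⊤

/-- Growth condition relative to `m`: `sup_x |F x| / (1 + |x|)^a < ∞` for some
`a ∈ [0, 1 / (2 m))`. -/
def GrowthCondition {d : ℕ} (F : Vec d → Vec d) (m : ℕ) : Prop :=
  ∃ a : ℝ, 0 ≤ a ∧ a < 1 / (2 * (m : ℝ)) ∧
    BddAbove (Set.range fun x : Vec d => ‖F x‖ / (1 + ‖x‖) ^ a)

/-- A Wiener process in `ℝ^n`: the coordinates are independent real Brownian motions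
(started at `0`, with almost surely continuous paths). -/
structure IsWiener {Ω : Type*} [MeasurableSpace Ω] (P : Measure Ω) {n : ℕ}
    (W : ℝ≥0 → Ω → Vec n) : Prop where
  coord : ∀ i : Fin n, IsBrownianReal (fun t ω => W t ω i) P
  indep : iIndepFun (fun (i : Fin n) (ω : Ω) (t : ℝ≥0) => W t ω i) P

/-- `y` is a continuous solution on `[0, ∞)` of
`y(t) = x + ∫₀ᵗ (A y(s) + F (y(s))) ds + B η(t)`. -/
def IsSolution {d n : ℕ} (A : Vec d →L[ℝ] Vec d) (F : Vec d → Vec d) (B : Vec n →L[ℝ] Vec d)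
    (x : Vec d) (η : ℝ≥0 → Vec n) (y : ℝ≥0 → Vec d) : Prop :=
  Continuous y ∧ ∀ t : ℝ≥0,
    y t = x + (∫ s in (0 : ℝ)..t, (A (y s.toNNReal) + F (y s.toNNReal))) + B (η t)

open Classical in
/-- The solution at time `t` of the integral equation with initial condition `x` and driving
path `η`. For Lipschitz `F` and continuous `η` it is the unique one, see
`isSolution_solution` and `IsSolution.eq_solution`; the value for other `η` is irrelevant. -/
noncomputable def solution {d n : ℕ} (A : Vec d →L[ℝ] Vec d) (F : Vec d → Vec d)
    (B : Vec n →L[ℝ] Vec d) (x : Vec d) (η : ℝ≥0 → Vec n) : ℝ≥0 → Vec d :=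
  if h : ∃ y, IsSolution A F B x η y then h.choose else 0

/-- The distribution `P_T(x, ·)` of the value at time `T` of the solution of
`dX = (A X + F X) dt + B dW`, `X_0 = x`. -/
noncomputable def transition {Ω : Type*} [MeasurableSpace Ω] (P : Measure Ω) {d n : ℕ}
    (W : ℝ≥0 → Ω → Vec n) (A : Vec d →L[ℝ] Vec d) (F : Vec d → Vec d) (B : Vec n →L[ℝ] Vec d)
    (T : ℝ≥0) (x : Vec d) : Measure (Vec d) :=
  P.map fun ω => solution A F B x (fun t => W t ω) T

section Solution

variable {d n : ℕ} {A : Vec d →L[ℝ] Vec d} {F : Vec d → Vec d} {B : Vec n →L[ℝ] Vec d}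
  {x : Vec d} {η : ℝ≥0 → Vec n}

theorem isSolution_solution (hF : ∃ K, LipschitzWith K F) (hη : Continuous η) :
    IsSolution A F B x η (solution A F B x η) := by
  obtain ⟨K, hK⟩ := hF
  have hex : ∃ y, IsSolution A F B x η y := by
    obtain ⟨y, hy, hy'⟩ := exists_volterra (A.lipschitz.add hK)
      (w := fun t => x + B (η t)) (by fun_prop)
    refine ⟨y, hy, fun t => ?_⟩
    rw [hy' t]
    abel
  rw [solution, dif_pos hex]
  exact hex.choose_spec

theorem IsSolution.eq_solution (hF : ∃ K, LipschitzWith K F) (hη : Continuous η)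
    {y : ℝ≥0 → Vec d} (hy : IsSolution A F B x η y) : y = solution A F B x η := by
  have hz := isSolution_solution (A := A) (B := B) (x := x) hF hη
  obtain ⟨K, hK⟩ := hF
  refine unique_volterra (A.lipschitz.add hK) (w := fun t => x + B (η t))
    hy.1 hz.1 (fun t => ?_) fun t => ?_
  · rw [hy.2 t]; abel_nf
  · rw [hz.2 t]; abel_nf

end Solution

/-- Any process that solves the equation almost surely has the law `transition`. -/
theorem map_eq_transition {Ω : Type*} [MeasurableSpace Ω] {P : Measure Ω} {d n : ℕ}
    {W : ℝ≥0 → Ω → Vec n} (hW : IsWiener P W) {A : Vec d →L[ℝ] Vec d} {F : Vec d → Vec d}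
    {B : Vec n →L[ℝ] Vec d} (hF : ∃ K, LipschitzWith K F) {x : Vec d} {X : ℝ≥0 → Ω → Vec d}
    (hX : ∀ᵐ ω ∂P, IsSolution A F B x (fun t => W t ω) (fun t => X t ω)) (T : ℝ≥0) :
    P.map (X T) = transition P W A F B T x := by
  refine Measure.map_congr ?_
  have hc : ∀ᵐ ω ∂P, ∀ i, Continuous fun t => W t ω i := ae_all_iff.2 fun i => (hW.coord i).cont
  filter_upwards [hX, hc] with ω h1 h2
  have h3 : Continuous fun t => W t ω := by
    have := (PiLp.continuous_toLp 2 fun _ : Fin n => ℝ).comp (continuous_pi h2)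
    exact this
  exact congrFun (h1.eq_solution hF h3) T

end LangevinSDE

/-!
The solution is a continuous function of the initial point, the driving path and the time, for
locally uniform convergence of driving paths; lower semicontinuity of `P_T(x, U)` for open `U`
follows, since the event `X_T(x) ∈ U` persists under small changes of `(x, T)`.

For positivity, the law of the Wiener process charges every neighbourhood of every continuous path
`φ` with `φ 0 = 0`: the deviation of Brownian motion from its piecewise linear interpolation on a
grid is independent of the values on the grid, because `min s (k h)` is affine in `s` on grid
cells. The deviation is small with positive probability for a fine grid, and the grid values are
partial sums of independent Gaussian increments. It thus suffices to find one driving path that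
steers `x` into `U`.

Such a path acts only on a short window `[T - τ, T]`, where derivatives of a smooth step move the
linear system by any prescribed element of the Kalman span. The trajectory has size
`O(τ ^ -(m - 1))` there, so that `F` contributes only `O(τ ^ (1 - (m - 1) a))`, which tends to `0`.
-/

open Filter
open scoped Topology

namespace LangevinSDE

section VolterraFlow

variable {E : Type*} [NormedAddCommGroup E] [NormedSpace ℝ E] {K : ℝ≥0} {G : E → E}

theorem gronwallBound_zero_mul (K c t : ℝ) :
    gronwallBound 0 K (K * c) t = c * Real.exp (K * t) - c := by
  rcases eq_or_ne K 0 with rfl | hK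
  · simp only [zero_mul, gronwallBound_K0, Real.exp_zero, mul_one, sub_self, add_zero]
  · simp only [gronwallBound_of_K_ne_0 hK, mul_div_cancel_left₀ c hK]
    ring

variable [CompleteSpace E]

theorem norm_integral_sub_le_of_norm_sub_le (hG : LipschitzWith K G) {y z : ℝ≥0 → E}
    (hy : Continuous y) (hz : Continuous z) {T : ℝ≥0} {c : ℝ}
    (h : ∀ t ≤ T, ‖y t - z t‖ ≤ c + ‖∫ s in (0 : ℝ)..t, (G (y s.toNNReal) - G (z s.toNNReal))‖)
    {t : ℝ≥0} (ht : t ≤ T) :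
    ‖∫ s in (0 : ℝ)..t, (G (y s.toNNReal) - G (z s.toNNReal))‖ ≤ c * Real.exp (K * t) - c := by
  have hGc := hG.continuous
  have hg : Continuous fun s : ℝ => G (y s.toNNReal) - G (z s.toNNReal) := by fun_prop
  have hderiv (s : ℝ) := hg.integral_hasStrictDerivAt 0 s
  have hbound : ∀ s ∈ Set.Ico (0 : ℝ) T, ‖G (y s.toNNReal) - G (z s.toNNReal)‖
      ≤ K * ‖∫ r in (0 : ℝ)..s, (G (y r.toNNReal) - G (z r.toNNReal))‖ + K * c := by
    intro s hs
    have hs' := h s.toNNReal (Real.toNNReal_le_iff_le_coe.2 hs.2.le)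
    rw [Real.coe_toNNReal s hs.1] at hs'
    calc _ ≤ K * ‖y s.toNNReal - z s.toNNReal‖ := hG.norm_sub_le _ _
      _ ≤ K * (c + _) := by gcongr
      _ = _ := by ring
  have hgronwall := norm_le_gronwallBound_of_norm_deriv_right_le (δ := 0)
    (fun s _ => (hderiv s).hasDerivAt.continuousAt.continuousWithinAt)
    (fun s _ => (hderiv s).hasDerivAt.hasDerivWithinAt)
    (by simp only [intervalIntegral.integral_same, norm_zero, le_refl]) hbound t
    ⟨t.coe_nonneg, NNReal.coe_le_coe.2 ht⟩
  rwa [gronwallBound_zero_mul, sub_zero] at hgronwall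

/-- The solution `y` of the Volterra equation `y t = w t + ∫₀ᵗ G (y s) ds`, as an element of the
space of continuous paths. -/
noncomputable def volterraFlow (hG : LipschitzWith K G) (w : C(ℝ≥0, E)) : C(ℝ≥0, E) where
  toFun := (exists_volterra hG w.continuous).choose
  continuous_toFun := (exists_volterra hG w.continuous).choose_spec.1

theorem volterraFlow_apply (hG : LipschitzWith K G) (w : C(ℝ≥0, E)) (t : ℝ≥0) :
    volterraFlow hG w t = w t + ∫ s in (0 : ℝ)..t, G (volterraFlow hG w s.toNNReal) :=
  (exists_volterra hG w.continuous).choose_spec.2 t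

theorem norm_volterraFlow_sub_le (hG : LipschitzWith K G) (w : C(ℝ≥0, E)) {z : ℝ≥0 → E}
    (hz : Continuous z) {T : ℝ≥0} {c : ℝ}
    (hdefect : ∀ t ≤ T, ‖w t + (∫ s in (0 : ℝ)..t, G (z s.toNNReal)) - z t‖ ≤ c)
    {t : ℝ≥0} (ht : t ≤ T) : ‖volterraFlow hG w t - z t‖ ≤ c * Real.exp (K * t) := by
  have hGc := hG.continuous
  have hy := (volterraFlow hG w).continuous
  have hle : ∀ t ≤ T, ‖volterraFlow hG w t - z t‖
      ≤ c + ‖∫ s in (0 : ℝ)..t, (G (volterraFlow hG w s.toNNReal) - G (z s.toNNReal))‖ := by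
    intro t ht
    have hsplit : volterraFlow hG w t - z t = (w t + (∫ s in (0 : ℝ)..t, G (z s.toNNReal)) - z t)
        + ∫ s in (0 : ℝ)..t, (G (volterraFlow hG w s.toNNReal) - G (z s.toNNReal)) := by
      rw [intervalIntegral.integral_sub (Continuous.intervalIntegrable (by fun_prop) _ _)
        (Continuous.intervalIntegrable (by fun_prop) _ _), volterraFlow_apply]
      abel
    rw [hsplit]
    exact (norm_add_le _ _).trans (by gcongr; exact hdefect t ht)
  linarith [hle t ht, norm_integral_sub_le_of_norm_sub_le hG hy hz hle ht]

theorem continuous_volterraFlow (hG : LipschitzWith K G) : Continuous (volterraFlow hG) := by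
  rw [continuous_iff_continuousAt]
  intro w
  refine ContinuousMap.tendsto_iff_forall_isCompact_tendstoUniformlyOn.2 fun k hk => ?_
  obtain ⟨T, hT⟩ := hk.bddAbove
  rw [Metric.tendstoUniformlyOn_iff]
  intro ε hε
  have hclose := Metric.tendstoUniformlyOn_iff.1
    (ContinuousMap.tendsto_iff_forall_isCompact_tendstoUniformlyOn.1 (Filter.tendsto_id (x := 𝓝 w))
      (Set.Icc 0 T) isCompact_Icc) (ε / 2 * Real.exp (-(K * T))) (by positivity)
  filter_upwards [hclose] with v hv t ht
  have hdefect : ∀ t ≤ T,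
      ‖w t + (∫ s in (0 : ℝ)..t, G (volterraFlow hG v s.toNNReal)) - volterraFlow hG v t‖
        ≤ ε / 2 * Real.exp (-(K * T)) := by
    intro t ht
    rw [volterraFlow_apply hG v t, add_sub_add_right_eq_sub, ← dist_eq_norm]
    exact (hv t ⟨zero_le, ht⟩).le
  rw [dist_eq_norm]
  calc ‖volterraFlow hG w t - volterraFlow hG v t‖
      ≤ ε / 2 * Real.exp (-(K * T)) * Real.exp (K * t) :=
        norm_volterraFlow_sub_le hG w (volterraFlow hG v).continuous hdefect (hT ht)
    _ ≤ ε / 2 * Real.exp (-(K * T)) * Real.exp (K * T) := by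
        gcongr
        exact hT ht
    _ = ε / 2 := by rw [mul_assoc, ← Real.exp_add, neg_add_cancel, Real.exp_zero, mul_one]
    _ < ε := half_lt_self hε

end VolterraFlow

section Forcing

variable {E U : Type*} [NormedAddCommGroup E] [NormedSpace ℝ E] [NormedAddCommGroup U]
  [NormedSpace ℝ U]

/-- The forcing path `t ↦ x + B (η t)`, which turns the equation started at `x` and driven by `η`
into a Volterra equation. -/
def forcing (B : U →L[ℝ] E) (x : E) (η : C(ℝ≥0, U)) : C(ℝ≥0, E) :=
  .const ℝ≥0 x + (B : C(U, E)).comp η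

theorem forcing_apply (B : U →L[ℝ] E) (x : E) (η : C(ℝ≥0, U)) (t : ℝ≥0) :
    forcing B x η t = x + B (η t) :=
  rfl

theorem continuous_forcing (B : U →L[ℝ] E) :
    Continuous fun p : E × C(ℝ≥0, U) => forcing B p.1 p.2 :=
  (ContinuousMap.continuous_const'.comp continuous_fst).add
    ((ContinuousMap.continuous_postcomp _).comp continuous_snd)

end Forcing

section Solution

variable {d n : ℕ} {A : Vec d →L[ℝ] Vec d} {F : Vec d → Vec d} {B : Vec n →L[ℝ] Vec d}

theorem solution_eq_volterraFlow {K : ℝ≥0} (hF : LipschitzWith K F) (x : Vec d)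
    (η : C(ℝ≥0, Vec n)) :
    solution A F B x η = volterraFlow (A.lipschitz.add hF) (forcing B x η) := by
  refine (IsSolution.eq_solution ⟨K, hF⟩ η.continuous
    ⟨ContinuousMap.continuous _, fun t => ?_⟩).symm
  rw [volterraFlow_apply, forcing_apply]
  abel

theorem continuous_solution (hF : ∃ K, LipschitzWith K F) :
    Continuous fun p : Vec d × C(ℝ≥0, Vec n) × ℝ≥0 => solution A F B p.1 p.2.1 p.2.2 := by
  obtain ⟨K, hF⟩ := hF
  simp only [solution_eq_volterraFlow hF]
  have hforcing : Continuous fun p : Vec d × C(ℝ≥0, Vec n) × ℝ≥0 => forcing B p.1 p.2.1 :=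
    (continuous_forcing B).comp (f := fun p : Vec d × C(ℝ≥0, Vec n) × ℝ≥0 => (p.1, p.2.1))
      (by fun_prop)
  exact ((continuous_volterraFlow (A.lipschitz.add hF)).comp hforcing).eval
    (continuous_snd.comp continuous_snd)

theorem continuous_solution_driving (hF : ∃ K, LipschitzWith K F) (x : Vec d) (T : ℝ≥0) :
    Continuous fun η : C(ℝ≥0, Vec n) => solution A F B x η T :=
  (continuous_solution hF).comp (f := fun η => (x, η, T)) (by fun_prop)

end Solution

section SmoothStep

open scoped ContDiff

theorem iteratedDeriv_eq_of_eqOn {V : Type*} [NormedAddCommGroup V] [NormedSpace ℝ V]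
    {f g : ℝ → V} {s : Set ℝ} {k : ℕ} (hs : UniqueDiffOn ℝ s) (hf : ContDiff ℝ k f)
    (hg : ContDiff ℝ k g) (h : Set.EqOn f g s) {x : ℝ} (hx : x ∈ s) :
    iteratedDeriv k f x = iteratedDeriv k g x := by
  rw [← iteratedDerivWithin_eq_iteratedDeriv hs hf.contDiffAt hx,
    ← iteratedDerivWithin_eq_iteratedDeriv hs hg.contDiffAt hx]
  exact iteratedDerivWithin_congr h hx

theorem iteratedDeriv_smoothTransition_of_nonpos (k : ℕ) {x : ℝ} (hx : x ≤ 0) :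
    iteratedDeriv k Real.smoothTransition x = 0 := by
  rw [iteratedDeriv_eq_of_eqOn (g := fun _ => 0) (uniqueDiffOn_Iic 0)
    Real.smoothTransition.contDiff contDiff_const
    (fun _ => Real.smoothTransition.zero_of_nonpos) hx, iteratedDeriv_const, ite_self]

theorem iteratedDeriv_smoothTransition_of_one_le (k : ℕ) {x : ℝ} (hx : 1 ≤ x) :
    iteratedDeriv k Real.smoothTransition x = if k = 0 then 1 else 0 := by
  rw [iteratedDeriv_eq_of_eqOn (g := fun _ => 1) (uniqueDiffOn_Ici 1)
    Real.smoothTransition.contDiff contDiff_const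
    (fun _ => Real.smoothTransition.one_of_one_le) hx, iteratedDeriv_const]

theorem exists_abs_iteratedDeriv_smoothTransition_le (k : ℕ) :
    ∃ M, ∀ x, |iteratedDeriv k Real.smoothTransition x| ≤ M := by
  obtain ⟨M, hM⟩ := (isCompact_Icc (a := (0 : ℝ)) (b := 1)).exists_bound_of_continuousOn
    (Real.smoothTransition.contDiff.continuous_iteratedDeriv k le_rfl).continuousOn
  refine ⟨M, fun x => ?_⟩
  rcases le_total x 0 with h0 | h0
  · rw [iteratedDeriv_smoothTransition_of_nonpos k h0,
      ← iteratedDeriv_smoothTransition_of_nonpos k le_rfl]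
    exact hM 0 ⟨le_rfl, zero_le_one⟩
  rcases le_total x 1 with h1 | h1
  · exact hM x ⟨h0, h1⟩
  · rw [iteratedDeriv_smoothTransition_of_one_le k h1,
      ← iteratedDeriv_smoothTransition_of_one_le k le_rfl]
    exact hM 1 ⟨zero_le_one, le_rfl⟩

/-- A smooth function that, for `0 < τ`, vanishes up to time `T - τ` and equals `1` from time `T`
on. -/
noncomputable def smoothStep (T τ t : ℝ) : ℝ :=
  Real.smoothTransition (τ⁻¹ * (t - (T - τ)))

variable {T τ : ℝ}

theorem contDiff_smoothStep : ContDiff ℝ ∞ (smoothStep T τ) :=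
  Real.smoothTransition.contDiff.comp (by fun_prop)

theorem iteratedDeriv_smoothStep (k : ℕ) (t : ℝ) :
    iteratedDeriv k (smoothStep T τ) t
      = τ⁻¹ ^ k * iteratedDeriv k Real.smoothTransition (τ⁻¹ * (t - (T - τ))) := by
  have hshift := iteratedDeriv_comp_sub_const k (fun s => Real.smoothTransition (τ⁻¹ * s)) (T - τ)
  have hscale := iteratedDeriv_comp_const_mul (n := k) Real.smoothTransition.contDiff τ⁻¹
  exact (congrFun hshift t).trans (congrFun hscale _)

theorem iteratedDeriv_smoothStep_of_le (hτ : 0 < τ) (k : ℕ) {t : ℝ} (ht : t ≤ T - τ) :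
    iteratedDeriv k (smoothStep T τ) t = 0 := by
  rw [iteratedDeriv_smoothStep, iteratedDeriv_smoothTransition_of_nonpos, mul_zero]
  exact mul_nonpos_of_nonneg_of_nonpos (inv_nonneg.2 hτ.le) (sub_nonpos.2 ht)

theorem iteratedDeriv_smoothStep_self (hτ : 0 < τ) (k : ℕ) :
    iteratedDeriv k (smoothStep T τ) T = if k = 0 then 1 else 0 := by
  have hone : τ⁻¹ * (T - (T - τ)) = 1 := by rw [sub_sub_cancel, inv_mul_cancel₀ hτ.ne']
  rw [iteratedDeriv_smoothStep, hone, iteratedDeriv_smoothTransition_of_one_le k le_rfl]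
  split_ifs with hk
  · rw [hk, pow_zero, mul_one]
  · rw [mul_zero]

theorem abs_smoothStep_le_one (t : ℝ) : |smoothStep T τ t| ≤ 1 :=
  abs_le.2 ⟨neg_one_lt_zero.le.trans (Real.smoothTransition.nonneg _),
    Real.smoothTransition.le_one _⟩

theorem exists_abs_iteratedDeriv_smoothStep_le (m : ℕ) :
    ∃ M, 0 ≤ M ∧ ∀ T τ t : ℝ, 0 < τ → τ ≤ 1 → ∀ k < m,
      |iteratedDeriv k (smoothStep T τ) t| ≤ M * τ⁻¹ ^ (m - 1) := by
  choose M hM using exists_abs_iteratedDeriv_smoothTransition_le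
  have hM0 (k : ℕ) : 0 ≤ M k := (abs_nonneg _).trans (hM k 0)
  have hsum : 0 ≤ ∑ k ∈ Finset.range m, M k := Finset.sum_nonneg fun k _ => hM0 k
  refine ⟨_, hsum, fun T τ t hτ hτ1 k hk => ?_⟩
  rw [iteratedDeriv_smoothStep, abs_mul, abs_of_pos (by positivity), mul_comm]
  gcongr
  · exact (hM k _).trans
      (Finset.single_le_sum (fun k _ => hM0 k) (Finset.mem_range.2 hk))
  · exact (one_le_inv₀ hτ).2 hτ1
  · exact Nat.le_sub_one_of_lt hk

end SmoothStep

section LinearSteering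

open scoped ContDiff

variable {E U : Type*} [NormedAddCommGroup E] [NormedSpace ℝ E] [NormedAddCommGroup U]
  [NormedSpace ℝ U] {A : E →L[ℝ] E} {B : U →L[ℝ] E} {θ : ℝ → ℝ} {m : ℕ} {v : ℕ → U} {t : ℝ}

theorem hasDerivAt_iteratedDeriv (hθ : ContDiff ℝ ∞ θ) (k : ℕ) (t : ℝ) :
    HasDerivAt (iteratedDeriv k θ) (iteratedDeriv (k + 1) θ t) t := by
  rw [iteratedDeriv_succ]
  exact (hθ.differentiable_iteratedDeriv k (mod_cast ENat.natCast_lt_top k) t).hasDerivAt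

/-- The path `∑ i ≤ j, θ⁽ⁱ⁾ • A ^ (j - i) u`, a response of the linear system `z' = A z` to forcing
in the direction `u`: it solves `z' = A z - θ • A ^ (j + 1) u + θ⁽ʲ⁺¹⁾ • u`. -/
noncomputable def chain (A : E →L[ℝ] E) (θ : ℝ → ℝ) (u : E) : ℕ → ℝ → E
  | 0, t => θ t • u
  | j + 1, t => A (chain A θ u j t) + iteratedDeriv (j + 1) θ t • u

theorem hasDerivAt_chain (hθ : ContDiff ℝ ∞ θ) (u : E) (j : ℕ) (t : ℝ) :
    HasDerivAt (chain A θ u j)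
      (A (chain A θ u j t) - θ t • (A ^ (j + 1)) u + iteratedDeriv (j + 1) θ t • u) t := by
  induction j with
  | zero =>
    convert! (hasDerivAt_iteratedDeriv hθ 0 t).smul_const u using 1
    simp only [chain, map_smul, zero_add, pow_one, sub_self]
  | succ j ih =>
    convert! (A.hasFDerivAt.comp_hasDerivAt t ih).add
      ((hasDerivAt_iteratedDeriv hθ (j + 1) t).smul_const u) using 1
    simp only [chain, map_add, map_sub, map_smul, pow_succ' A (j + 1), mul_apply_eq_comp]
    abel

theorem chain_eq_zero (u : E) (h : ∀ k, iteratedDeriv k θ t = 0) (j : ℕ) :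
    chain A θ u j t = 0 := by
  induction j with
  | zero => rw [chain, ← iteratedDeriv_zero (f := θ), h, zero_smul]
  | succ j ih => rw [chain, ih, h, map_zero, zero_smul, add_zero]

theorem chain_eq_pow (u : E) (h : ∀ k, iteratedDeriv k θ t = if k = 0 then 1 else 0) (j : ℕ) :
    chain A θ u j t = (A ^ j) u := by
  induction j with
  | zero => rw [chain, ← iteratedDeriv_zero (f := θ), h, if_pos rfl, one_smul, pow_zero,
      one_apply_eq_self]
  | succ j ih => rw [chain, ih, h, if_neg j.succ_ne_zero, zero_smul, add_zero, pow_succ',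
      mul_apply_eq_comp]

theorem norm_chain_le (u : E) {j : ℕ} {c : ℝ} (h : ∀ k ≤ j, |iteratedDeriv k θ t| ≤ c) :
    ‖chain A θ u j t‖ ≤ c * ((∑ i ∈ Finset.range (j + 1), ‖A‖ ^ i) * ‖u‖) := by
  induction j with
  | zero =>
    rw [chain, norm_smul, Finset.sum_range_one, pow_zero, one_mul]
    gcongr
    simpa only [iteratedDeriv_zero, Real.norm_eq_abs] using h 0 le_rfl
  | succ j ih =>
    calc ‖chain A θ u (j + 1) t‖
        ≤ ‖A‖ * ‖chain A θ u j t‖ + |iteratedDeriv (j + 1) θ t| * ‖u‖ :=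
          (norm_add_le _ _).trans (add_le_add (A.le_opNorm _) (norm_smul _ _).le)
      _ ≤ ‖A‖ * (c * ((∑ i ∈ Finset.range (j + 1), ‖A‖ ^ i) * ‖u‖)) + c * ‖u‖ := by
          gcongr
          · exact ih fun k hk => h k (hk.trans j.le_succ)
          · exact h (j + 1) le_rfl
      _ = c * ((∑ i ∈ Finset.range (j + 2), ‖A‖ ^ i) * ‖u‖) := by
          simp only [Finset.sum_range_succ' _ (j + 1), pow_succ', ← Finset.mul_sum]
          ring

/-- The control `∑ j < m, θ⁽ʲ⁾ • v j`. -/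
noncomputable def steeringControl (θ : ℝ → ℝ) (m : ℕ) (v : ℕ → U) (t : ℝ) : U :=
  ∑ j ∈ Finset.range m, iteratedDeriv j θ t • v j

/-- The response to the control `η = steeringControl θ m v`: it solves
`z' = A z + B η' - θ • steeringSource A B m v`. -/
noncomputable def steeringPath (A : E →L[ℝ] E) (B : U →L[ℝ] E) (θ : ℝ → ℝ) (m : ℕ) (v : ℕ → U)
    (t : ℝ) : E :=
  ∑ j ∈ Finset.range m, chain A θ (B (v j)) j t

/-- The direction of the source term left over in the equation for `steeringPath`. -/
noncomputable def steeringSource (A : E →L[ℝ] E) (B : U →L[ℝ] E) (m : ℕ) (v : ℕ → U) : E :=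
  ∑ j ∈ Finset.range m, (A ^ (j + 1)) (B (v j))

theorem hasDerivAt_steeringControl (hθ : ContDiff ℝ ∞ θ) (t : ℝ) :
    HasDerivAt (steeringControl θ m v)
      (∑ j ∈ Finset.range m, iteratedDeriv (j + 1) θ t • v j) t :=
  HasDerivAt.fun_sum fun j _ => (hasDerivAt_iteratedDeriv hθ j t).smul_const _

theorem hasDerivAt_steeringPath (hθ : ContDiff ℝ ∞ θ) (t : ℝ) :
    HasDerivAt (steeringPath A B θ m v) (A (steeringPath A B θ m v t)
      - θ t • steeringSource A B m v
      + B (∑ j ∈ Finset.range m, iteratedDeriv (j + 1) θ t • v j)) t := by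
  convert! HasDerivAt.fun_sum fun j (_ : j ∈ Finset.range m) =>
    hasDerivAt_chain hθ (B (v j)) j t using 1
  simp only [steeringPath, steeringSource, map_sum, map_smul, Finset.smul_sum,
    Finset.sum_add_distrib, Finset.sum_sub_distrib]

theorem continuous_steeringControl (hθ : ContDiff ℝ ∞ θ) : Continuous (steeringControl θ m v) :=
  continuous_iff_continuousAt.2 fun t => (hasDerivAt_steeringControl hθ t).continuousAt

theorem continuous_steeringPath (hθ : ContDiff ℝ ∞ θ) : Continuous (steeringPath A B θ m v) :=
  continuous_iff_continuousAt.2 fun t => (hasDerivAt_steeringPath hθ t).continuousAt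

theorem steeringControl_eq_zero (h : ∀ k, iteratedDeriv k θ t = 0) :
    steeringControl θ m v t = 0 :=
  Finset.sum_eq_zero fun j _ => by rw [h, zero_smul]

theorem steeringPath_eq_zero (h : ∀ k, iteratedDeriv k θ t = 0) :
    steeringPath A B θ m v t = 0 :=
  Finset.sum_eq_zero fun j _ => chain_eq_zero _ h j

theorem steeringPath_eq_sum (h : ∀ k, iteratedDeriv k θ t = if k = 0 then 1 else 0) :
    steeringPath A B θ m v t = ∑ j ∈ Finset.range m, (A ^ j) (B (v j)) :=
  Finset.sum_congr rfl fun j _ => chain_eq_pow _ h j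

theorem norm_steeringPath_le {c : ℝ} (h : ∀ k < m, |iteratedDeriv k θ t| ≤ c) :
    ‖steeringPath A B θ m v t‖
      ≤ c * ∑ j ∈ Finset.range m, (∑ i ∈ Finset.range (j + 1), ‖A‖ ^ i) * ‖B (v j)‖ := by
  rw [Finset.mul_sum]
  exact norm_sum_le_of_le _ fun j hj =>
    norm_chain_le _ fun k hk => h k (hk.trans_lt (Finset.mem_range.1 hj))

theorem steeringPath_eq_integral [CompleteSpace E] (hθ : ContDiff ℝ ∞ θ)
    (h : ∀ k, iteratedDeriv k θ 0 = 0) (t : ℝ) :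
    steeringPath A B θ m v t
      = (∫ s in (0 : ℝ)..t, (A (steeringPath A B θ m v s) - θ s • steeringSource A B m v))
        + B (steeringControl θ m v t) := by
  have hderiv (s : ℝ) := (hasDerivAt_steeringPath (A := A) (B := B) (m := m) (v := v) hθ s).sub
    (B.hasFDerivAt.comp_hasDerivAt s (hasDerivAt_steeringControl (m := m) (v := v) hθ s))
  have hcont := continuous_steeringPath (A := A) (B := B) (m := m) (v := v) hθ
  have hθc := hθ.continuous
  simp only [add_sub_cancel_right] at hderiv
  rw [intervalIntegral.integral_eq_sub_of_hasDerivAt (fun s _ => hderiv s)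
    (Continuous.intervalIntegrable (by fun_prop) 0 t)]
  simp only [Pi.sub_apply, Function.comp_apply, steeringPath_eq_zero h,
    steeringControl_eq_zero h, map_zero, sub_zero, sub_add_cancel]

end LinearSteering

section NonlinearSteering

theorem norm_integral_le_of_eq_zero_of_le {E : Type*} [NormedAddCommGroup E] [NormedSpace ℝ E]
    {g : ℝ → E} {T τ H : ℝ} (hτ : 0 ≤ τ) (hH : 0 ≤ H) (hg₀ : ∀ s ≤ T - τ, g s = 0)
    (hg : ∀ s ∈ Set.Icc 0 T, ‖g s‖ ≤ H) {t : ℝ} (ht : t ∈ Set.Icc 0 T) :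
    ‖∫ s in (0 : ℝ)..t, g s‖ ≤ H * τ := by
  rw [intervalIntegral.integral_of_le ht.1, setIntegral_eq_of_subset_of_forall_sdiff_eq_zero
    (s := Set.Ioc 0 t ∩ Set.Ioc (T - τ) T) measurableSet_Ioc Set.inter_subset_left]
  · refine (norm_setIntegral_le_of_norm_le_const
      ((measure_mono Set.inter_subset_left).trans_lt measure_Ioc_lt_top)
      fun s hs => hg s ⟨hs.1.1.le, hs.2.2⟩).trans ?_
    gcongr
    refine (measureReal_mono Set.inter_subset_right measure_Ioc_lt_top.ne).trans_eq ?_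
    rw [Real.volume_real_Ioc_of_le (by linarith), sub_sub_cancel]
  · intro s hs
    exact hg₀ s (not_lt.1 fun h => hs.2 ⟨hs.1, h, hs.1.2.trans ht.2⟩)

theorem tendsto_inv_pow_rpow_mul_self {q : ℕ} {a : ℝ} (h : q * a < 1) :
    Tendsto (fun τ : ℝ => (τ⁻¹ ^ q) ^ a * τ) (𝓝[>] 0) (𝓝 0) := by
  have hrpow : Tendsto (fun τ : ℝ => τ ^ (1 - q * a)) (𝓝[>] 0) (𝓝 0) := by
    have hcont := (Real.continuousAt_rpow_const 0 (1 - q * a) (Or.inr (by linarith))).tendsto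
    rw [Real.zero_rpow (by linarith)] at hcont
    exact hcont.mono_left nhdsWithin_le_nhds
  refine hrpow.congr' ?_
  filter_upwards [self_mem_nhdsWithin] with τ hτ
  have hτ0 : 0 < τ := hτ
  rw [← Real.rpow_natCast, Real.inv_rpow hτ0.le, ← Real.rpow_neg hτ0.le, ← Real.rpow_mul hτ0.le,
    ← Real.rpow_add_one hτ0.ne']
  congr 1
  ring

section Growth

variable {E : Type*} [NormedAddCommGroup E] {F : E → E} {a C : ℝ}

theorem norm_apply_add_le_rpow (ha : 0 ≤ a) (hF : ∀ x, ‖F x‖ ≤ C * (1 + ‖x‖) ^ a)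
    {Y N p : ℝ} (hN : 0 ≤ N) (hp : 1 ≤ p) {y z : E} (hy : ‖y‖ ≤ Y) (hz : ‖z‖ ≤ N * p) :
    ‖F (y + z)‖ ≤ C * (1 + Y + N) ^ a * p ^ a := by
  have hC : 0 ≤ C := by simpa using (norm_nonneg (F 0)).trans (hF 0)
  have hY : 0 ≤ Y := (norm_nonneg y).trans hy
  have hle : 1 + ‖y + z‖ ≤ (1 + Y + N) * p := by
    have hYp : 1 + Y ≤ (1 + Y) * p := le_mul_of_one_le_right (by positivity) hp
    linarith [norm_add_le y z]
  calc ‖F (y + z)‖ ≤ C * (1 + ‖y + z‖) ^ a := hF _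
    _ ≤ C * ((1 + Y + N) * p) ^ a := by gcongr
    _ = C * (1 + Y + N) ^ a * p ^ a := by
        rw [Real.mul_rpow (by positivity) (by positivity), mul_assoc]

theorem norm_apply_add_sub_apply_add_le_rpow (ha : 0 ≤ a)
    (hF : ∀ x, ‖F x‖ ≤ C * (1 + ‖x‖) ^ a) {Y N p : ℝ} (hN : 0 ≤ N) (hp : 1 ≤ p) {y z w : E}
    (hy : ‖y‖ ≤ Y) (hz : ‖z‖ ≤ N * p) :
    ‖F (y + z) - F y + w‖ ≤ (2 * (C * (1 + Y + N) ^ a) + ‖w‖) * p ^ a := by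
  have hFz := norm_apply_add_le_rpow ha hF hN hp hy hz
  have hFy : ‖F y‖ ≤ C * (1 + Y + N) ^ a * p ^ a := by
    simpa only [add_zero] using
      norm_apply_add_le_rpow (z := 0) ha hF hN hp hy (by rw [norm_zero]; positivity)
  have hw : ‖w‖ ≤ ‖w‖ * p ^ a := le_mul_of_one_le_right (norm_nonneg w) (Real.one_le_rpow hp ha)
  linarith [norm_add_le (F (y + z) - F y) w, norm_sub_le (F (y + z)) (F y)]

end Growth

variable {E U : Type*} [NormedAddCommGroup E] [NormedSpace ℝ E] [NormedAddCommGroup U]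
  [NormedSpace ℝ U] {A : E →L[ℝ] E} {B : U →L[ℝ] E} {F : E → E}

theorem defect_add_eq_integral (hF : Continuous F) {x : E} {y : C(ℝ≥0, E)}
    (hy : ∀ t : ℝ≥0, y t = x + ∫ s in (0 : ℝ)..t, (A (y s.toNNReal) + F (y s.toNNReal)))
    {η : C(ℝ≥0, U)} {S r : ℝ → E} (hS : Continuous S) (hr : Continuous r)
    (hSη : ∀ t : ℝ≥0, S t = (∫ s in (0 : ℝ)..t, (A (S s) - r s)) + B (η t)) (t : ℝ≥0) :
    forcing B x η t + (∫ s in (0 : ℝ)..t, (A (y s.toNNReal + S s.toNNReal)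
        + F (y s.toNNReal + S s.toNNReal))) - (y t + S t)
      = ∫ s in (0 : ℝ)..t, (F (y s.toNNReal + S s) - F (y s.toNNReal) + r s) := by
  have hsplit : ∫ s in (0 : ℝ)..t, (A (y s.toNNReal + S s.toNNReal)
        + F (y s.toNNReal + S s.toNNReal))
      = (∫ s in (0 : ℝ)..t, (A (y s.toNNReal) + F (y s.toNNReal)))
        + (∫ s in (0 : ℝ)..t, (A (S s) - r s))
        + ∫ s in (0 : ℝ)..t, (F (y s.toNNReal + S s) - F (y s.toNNReal) + r s) := by
    rw [← intervalIntegral.integral_add, ← intervalIntegral.integral_add]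
    · refine intervalIntegral.integral_congr fun s hs => ?_
      rw [Set.uIcc_of_le t.coe_nonneg] at hs
      simp only [Real.coe_toNNReal s hs.1, map_add]
      abel
    all_goals exact Continuous.intervalIntegrable (by fun_prop) _ _
  rw [hsplit, hy t, hSη t, forcing_apply]
  abel

/-- The control `steeringControl θ m v` for the smooth step `θ` on `[T - τ, T]`, as a path. -/
noncomputable def stepControl (T τ : ℝ) (m : ℕ) (v : ℕ → U) : C(ℝ≥0, U) where
  toFun t := steeringControl (smoothStep T τ) m v t
  continuous_toFun :=
    (continuous_steeringControl contDiff_smoothStep).comp NNReal.continuous_coe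

theorem stepControl_zero {T τ : ℝ} (hτ : 0 < τ) (hτT : τ ≤ T) (m : ℕ) (v : ℕ → U) :
    stepControl T τ m v 0 = 0 :=
  steeringControl_eq_zero fun k => iteratedDeriv_smoothStep_of_le hτ k (sub_nonneg.2 hτT)

theorem exists_norm_steeringPath_smoothStep_le (A : E →L[ℝ] E) (B : U →L[ℝ] E) (m : ℕ)
    (v : ℕ → U) :
    ∃ N, 0 ≤ N ∧ ∀ T τ t : ℝ, 0 < τ → τ ≤ 1 →
      ‖steeringPath A B (smoothStep T τ) m v t‖ ≤ N * τ⁻¹ ^ (m - 1) := by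
  obtain ⟨M, hM, hθ⟩ := exists_abs_iteratedDeriv_smoothStep_le m
  refine ⟨M * ∑ j ∈ Finset.range m, (∑ i ∈ Finset.range (j + 1), ‖A‖ ^ i) * ‖B (v j)‖,
    by positivity, fun T τ t hτ hτ1 => ?_⟩
  rw [mul_right_comm]
  exact norm_steeringPath_le (hθ T τ t hτ hτ1)

variable [CompleteSpace E] {K : ℝ≥0}

theorem norm_volterraFlow_stepControl_sub_le (hF : LipschitzWith K F) {a C : ℝ} (ha : 0 ≤ a)
    (hbound : ∀ x, ‖F x‖ ≤ C * (1 + ‖x‖) ^ a) {x : E} {T : ℝ≥0} {m : ℕ} {v : ℕ → U} {Y N p τ : ℝ}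
    (hY : ∀ t ≤ T, ‖volterraFlow (A.lipschitz.add hF) (forcing B x 0) t‖ ≤ Y) (hN : 0 ≤ N)
    (hp : 1 ≤ p) (hτ : 0 < τ) (hτT : τ ≤ T)
    (hS : ∀ t, ‖steeringPath A B (smoothStep T τ) m v t‖ ≤ N * p) :
    ‖volterraFlow (A.lipschitz.add hF) (forcing B x (stepControl T τ m v)) T
        - (volterraFlow (A.lipschitz.add hF) (forcing B x 0) T
          + ∑ j ∈ Finset.range m, (A ^ j) (B (v j)))‖
      ≤ (2 * (C * (1 + Y + N) ^ a) + ‖steeringSource A B m v‖) * p ^ a * τ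
        * Real.exp ((‖A‖₊ + K : ℝ≥0) * T) := by
  set y := volterraFlow (A.lipschitz.add hF) (forcing B x 0)
  set S := steeringPath A B (smoothStep T τ) m v
  have hy (t : ℝ≥0) : y t = x + ∫ s in (0 : ℝ)..t, (A (y s.toNNReal) + F (y s.toNNReal)) := by
    simpa only [forcing_apply, ContinuousMap.zero_apply, map_zero, add_zero]
      using volterraFlow_apply (A.lipschitz.add hF) (forcing B x 0) t
  have hC : 0 ≤ C := by simpa using (norm_nonneg (F 0)).trans (hbound 0)
  have hY0 : 0 ≤ Y := (norm_nonneg _).trans (hY T le_rfl)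
  have hSc : Continuous S := continuous_steeringPath contDiff_smoothStep
  have hθc : Continuous (smoothStep T τ) := contDiff_smoothStep.continuous
  have hdefect (t : ℝ≥0) (ht : t ≤ T) : ‖forcing B x (stepControl T τ m v) t
      + (∫ s in (0 : ℝ)..t, (A (y s.toNNReal + S s.toNNReal) + F (y s.toNNReal + S s.toNNReal)))
      - (y t + S t)‖ ≤ (2 * (C * (1 + Y + N) ^ a) + ‖steeringSource A B m v‖) * p ^ a * τ := by
    rw [defect_add_eq_integral (r := fun s => smoothStep T τ s • steeringSource A B m v)
      hF.continuous hy hSc (by fun_prop) fun t => steeringPath_eq_integral contDiff_smoothStep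
        (fun k => iteratedDeriv_smoothStep_of_le hτ k (sub_nonneg.2 hτT)) t]
    refine norm_integral_le_of_eq_zero_of_le hτ.le (by positivity) (fun s hs => ?_)
      (fun s hs => ?_) ⟨t.2, NNReal.coe_le_coe.2 ht⟩
    · have hθ0 (k : ℕ) := iteratedDeriv_smoothStep_of_le hτ k hs
      rw [← iteratedDeriv_zero (f := smoothStep T τ), hθ0,
        show S s = 0 from steeringPath_eq_zero hθ0, add_zero, sub_self, zero_smul, add_zero]
    · refine (norm_apply_add_sub_apply_add_le_rpow ha hbound hN hp
        (hY _ (Real.toNNReal_le_iff_le_coe.2 hs.2)) (hS s)).trans ?_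
      gcongr
      rw [norm_smul]
      exact mul_le_of_le_one_left (norm_nonneg _) (abs_smoothStep_le_one s)
  rw [← steeringPath_eq_sum (iteratedDeriv_smoothStep_self hτ)]
  exact norm_volterraFlow_sub_le (A.lipschitz.add hF) _
    (y.continuous.add (hSc.comp NNReal.continuous_coe)) hdefect le_rfl

theorem tendsto_volterraFlow_stepControl (hF : LipschitzWith K F) {m : ℕ} {a C : ℝ}
    (ha : 0 ≤ a) (hma : (m - 1 : ℕ) * a < 1) (hbound : ∀ x, ‖F x‖ ≤ C * (1 + ‖x‖) ^ a) (x : E)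
    {T : ℝ≥0} (hT : 0 < T) (v : ℕ → U) :
    Tendsto
      (fun τ => volterraFlow (A.lipschitz.add hF) (forcing B x (stepControl T τ m v)) T) (𝓝[>] 0)
      (𝓝 (volterraFlow (A.lipschitz.add hF) (forcing B x 0) T
        + ∑ j ∈ Finset.range m, (A ^ j) (B (v j)))) := by
  set y := volterraFlow (A.lipschitz.add hF) (forcing B x 0)
  obtain ⟨Y, hY⟩ := (isCompact_Icc (a := (0 : ℝ≥0)) (b := T)).exists_bound_of_continuousOn
    y.continuous.continuousOn
  obtain ⟨N, hN, hS⟩ := exists_norm_steeringPath_smoothStep_le A B m v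
  have hlim := ((tendsto_inv_pow_rpow_mul_self hma).const_mul
    (2 * (C * (1 + Y + N) ^ a) + ‖steeringSource A B m v‖)).mul_const
      (Real.exp ((‖A‖₊ + K : ℝ≥0) * T))
  simp only [mul_zero, zero_mul] at hlim
  rw [tendsto_iff_norm_sub_tendsto_zero]
  refine squeeze_zero' (Eventually.of_forall fun _ => norm_nonneg _) ?_ hlim
  filter_upwards [Ioc_mem_nhdsGT (lt_min one_pos (NNReal.coe_pos.2 hT))] with τ hτ
  have hτ1 : τ ≤ 1 := hτ.2.trans (min_le_left _ _)
  refine (norm_volterraFlow_stepControl_sub_le hF ha hbound (fun t ht => hY t ⟨zero_le, ht⟩) hN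
    (one_le_pow₀ ((one_le_inv₀ hτ.1).2 hτ1)) hτ.1 (hτ.2.trans (min_le_right _ _))
    fun t => hS T τ t hτ.1 hτ1).trans_eq ?_
  rw [mul_assoc _ (_ ^ a)]

end NonlinearSteering

section KalmanSteering

variable {d n : ℕ} {A : Vec d →L[ℝ] Vec d} {F : Vec d → Vec d} {B : Vec n →L[ℝ] Vec d} {m : ℕ}

theorem exists_eq_sum_of_kalmanSpan_eq_top (hm : kalmanSpan A B m = ⊤) (e : Vec d) :
    ∃ v : ℕ → Vec n, ∑ j ∈ Finset.range m, (A ^ j) (B (v j)) = e := by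
  have he : e ∈ kalmanSpan A B m := hm ▸ Submodule.mem_top
  rw [kalmanSpan] at he
  induction he using Submodule.span_induction with
  | mem x hx =>
    obtain ⟨k, hk, i, rfl⟩ := hx
    refine ⟨Pi.single k (EuclideanSpace.single i 1), ?_⟩
    rw [Finset.sum_eq_single_of_mem k (Finset.mem_range.2 hk), Pi.single_eq_same]
    intro j _ hj
    rw [Pi.single_eq_of_ne hj, map_zero, map_zero]
  | zero => exact ⟨0, by simp only [Pi.zero_apply, map_zero, Finset.sum_const_zero]⟩
  | add x y _ _ hx hy =>
    obtain ⟨v, rfl⟩ := hx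
    obtain ⟨w, rfl⟩ := hy
    exact ⟨v + w, by simp only [Pi.add_apply, map_add, Finset.sum_add_distrib]⟩
  | smul c x _ hx =>
    obtain ⟨v, rfl⟩ := hx
    exact ⟨c • v, by simp only [Pi.smul_apply, map_smul, Finset.smul_sum]⟩

theorem GrowthCondition.exists_norm_le (h : GrowthCondition F m) :
    ∃ a C : ℝ, 0 ≤ a ∧ (m - 1 : ℕ) * a < 1 ∧ ∀ x, ‖F x‖ ≤ C * (1 + ‖x‖) ^ a := by
  obtain ⟨a, ha, ham, C, hC⟩ := h
  refine ⟨a, C, ha, ?_, fun x => (div_le_iff₀ (by positivity)).1 (hC ⟨x, rfl⟩)⟩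
  rcases m.eq_zero_or_pos with rfl | hm
  · simp only [zero_tsub, CharP.cast_eq_zero, zero_mul, zero_lt_one]
  · have hm' : (0 : ℝ) < m := mod_cast hm
    rw [lt_div_iff₀ (by positivity)] at ham
    have hle : ((m - 1 : ℕ) : ℝ) * a ≤ m * a := by gcongr; exact m.sub_le 1
    nlinarith

theorem exists_solution_mem (hF : ∃ K, LipschitzWith K F) (hm : kalmanSpan A B m = ⊤) {a C : ℝ}
    (ha : 0 ≤ a) (hma : (m - 1 : ℕ) * a < 1) (hbound : ∀ x, ‖F x‖ ≤ C * (1 + ‖x‖) ^ a)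
    {O : Set (Vec d)} (hO : IsOpen O) (hne : O.Nonempty) (x : Vec d) {T : ℝ≥0} (hT : 0 < T) :
    ∃ η : C(ℝ≥0, Vec n), η 0 = 0 ∧ solution A F B x η T ∈ O := by
  obtain ⟨K, hF⟩ := hF
  obtain ⟨x₀, hx₀⟩ := hne
  obtain ⟨v, hv⟩ := exists_eq_sum_of_kalmanSpan_eq_top hm
    (x₀ - volterraFlow (A.lipschitz.add hF) (forcing B x 0) T)
  have hlim := tendsto_volterraFlow_stepControl (A := A) (B := B) hF ha hma hbound x hT v
  rw [hv, add_sub_cancel] at hlim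
  obtain ⟨τ, hτO, hτ⟩ := ((hlim.eventually (hO.mem_nhds hx₀)).and
    (Ioc_mem_nhdsGT (NNReal.coe_pos.2 hT))).exists
  refine ⟨stepControl T τ m v, stepControl_zero hτ.1 hτ.2 m v, ?_⟩
  rwa [solution_eq_volterraFlow hF]

end KalmanSteering

section GridInterpolation

variable {E : Type*} [NormedAddCommGroup E] [NormedSpace ℝ E] {h : ℝ≥0} {f g : ℝ≥0 → E} {t : ℝ≥0}

/-- Piecewise linear interpolation of `f` on the grid `{0, h, 2 h, …}`. -/
noncomputable def gridInterp (h : ℝ≥0) (f : ℝ≥0 → E) (t : ℝ≥0) : E :=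
  AffineMap.lineMap (f (⌊t / h⌋₊ * h)) (f ((⌊t / h⌋₊ + 1) * h)) (t / h - ⌊t / h⌋₊ : ℝ)

theorem gridInterp_eq_add (h : ℝ≥0) (f : ℝ≥0 → E) (t : ℝ≥0) :
    gridInterp h f t = (1 - (t / h - ⌊t / h⌋₊ : ℝ)) • f (⌊t / h⌋₊ * h)
      + (t / h - ⌊t / h⌋₊ : ℝ) • f ((⌊t / h⌋₊ + 1) * h) :=
  AffineMap.lineMap_apply_module _ _ _

theorem gridInterp_sub (h : ℝ≥0) (f g : ℝ≥0 → E) (t : ℝ≥0) :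
    gridInterp h (fun s => f s - g s) t = gridInterp h f t - gridInterp h g t := by
  simp only [gridInterp_eq_add, smul_sub]
  abel

theorem gridInterp_mem {s : Set E} (hs : Convex ℝ s) (hl : f (⌊t / h⌋₊ * h) ∈ s)
    (hr : f ((⌊t / h⌋₊ + 1) * h) ∈ s) : gridInterp h f t ∈ s := by
  have hle : (⌊t / h⌋₊ : ℝ) ≤ t / h := mod_cast Nat.floor_le (zero_le (a := t / h))
  have hlt : (t / h : ℝ) < ⌊t / h⌋₊ + 1 := mod_cast Nat.lt_floor_add_one (t / h)
  exact hs.lineMap_mem hl hr ⟨by linarith, by linarith⟩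

theorem floor_div_mul_le (hh : 0 < h) (t : ℝ≥0) : ⌊t / h⌋₊ * h ≤ t :=
  (le_div_iff₀ hh).1 (Nat.floor_le zero_le)

theorem lt_floor_div_add_one_mul (hh : 0 < h) (t : ℝ≥0) : t < (⌊t / h⌋₊ + 1) * h :=
  (div_lt_iff₀ hh).1 (Nat.lt_floor_add_one _)

theorem dist_gridInterp_gridInterp_le {N : ℕ} {c : ℝ} (ht : ⌊t / h⌋₊ < N)
    (hfg : ∀ k ≤ N, dist (f (k * h)) (g (k * h)) ≤ c) :
    dist (gridInterp h f t) (gridInterp h g t) ≤ c := by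
  have hgrid (k : ℕ) (hk : k ≤ N) : f (k * h) - g (k * h) ∈ Metric.closedBall 0 c := by
    simpa only [mem_closedBall_zero_iff, ← dist_eq_norm] using hfg k hk
  rw [dist_eq_norm, ← gridInterp_sub, ← mem_closedBall_zero_iff]
  exact gridInterp_mem (convex_closedBall _ _) (hgrid _ ht.le) (mod_cast hgrid _ ht)

theorem eventually_dist_gridInterp_le (hf : Continuous f) (T : ℝ≥0) {ε : ℝ} (hε : 0 < ε) :
    ∀ᶠ h in 𝓝[>] (0 : ℝ≥0), ∀ t ≤ T, dist (gridInterp h f t) (f t) ≤ ε := by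
  obtain ⟨ρ, hρ, hunif⟩ := Metric.uniformContinuousOn_iff_le.1
    ((isCompact_Icc (a := (0 : ℝ≥0)) (b := T + 1)).uniformContinuousOn_of_continuous
      hf.continuousOn) ε hε
  filter_upwards [Ioc_mem_nhdsGT (lt_min one_pos (Real.toNNReal_pos.2 hρ))] with h hh t ht
  have hgrid (s : ℝ≥0) (hts : t ≤ s + h) (hst : s ≤ t + h) : f s ∈ Metric.closedBall (f t) ε := by
    have hρ' : (h : ℝ) ≤ ρ := (Real.le_toNNReal_iff_coe_le hρ.le).1 (hh.2.trans (min_le_right _ _))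
    refine hunif s ⟨zero_le, hst.trans (add_le_add ht (hh.2.trans (min_le_left _ _)))⟩ t
      ⟨zero_le, ht.trans le_self_add⟩ (hρ'.trans' ?_)
    rw [NNReal.dist_eq, abs_sub_le_iff, sub_le_iff_le_add', sub_le_iff_le_add']
    exact ⟨mod_cast hst, mod_cast hts⟩
  have hle := floor_div_mul_le hh.1 t
  have hlt := lt_floor_div_add_one_mul hh.1 t
  rw [add_one_mul] at hlt
  refine gridInterp_mem (convex_closedBall _ _) (hgrid _ hlt.le (hle.trans le_self_add))
    (hgrid _ ?_ ?_)
  · rw [add_one_mul]; exact hlt.le.trans le_self_add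
  · rw [add_one_mul]; gcongr

theorem gridInterp_coe (hh : 0 < h) (t : ℝ≥0) : gridInterp h (fun s => (s : ℝ)) t = t := by
  have hh' : (h : ℝ) ≠ 0 := mod_cast hh.ne'
  simp only [gridInterp_eq_add, smul_eq_mul]
  push_cast
  field_simp
  ring

theorem gridInterp_min (hh : 0 < h) (k : ℕ) (t : ℝ≥0) :
    gridInterp h (fun s => min (s : ℝ) (k * h)) t = min (t : ℝ) (k * h) := by
  have hle : (⌊t / h⌋₊ * h : ℝ) ≤ t := mod_cast floor_div_mul_le hh t
  have hlt : (t : ℝ) ≤ (⌊t / h⌋₊ + 1) * h := mod_cast (lt_floor_div_add_one_mul hh t).le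
  rcases le_or_gt k ⌊t / h⌋₊ with hk | hk
  · have hkh : (k * h : ℝ) ≤ ⌊t / h⌋₊ * h := by gcongr
    simp only [gridInterp, NNReal.coe_mul, NNReal.coe_add, NNReal.coe_natCast, NNReal.coe_one]
    rw [min_eq_right hkh, min_eq_right (hkh.trans (hle.trans hlt)), min_eq_right (hkh.trans hle),
      AffineMap.lineMap_same_apply]
  · have hkh : ((⌊t / h⌋₊ + 1) * h : ℝ) ≤ k * h := by gcongr; exact_mod_cast hk
    rw [min_eq_left (hlt.trans hkh)]
    conv_rhs => rw [← gridInterp_coe hh t]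
    simp only [gridInterp, NNReal.coe_mul, NNReal.coe_add, NNReal.coe_natCast, NNReal.coe_one]
    rw [min_eq_left (hle.trans (hlt.trans hkh)), min_eq_left hkh]

end GridInterpolation

section BrownianSupport

variable {Ω : Type*} [MeasurableSpace Ω] {P : Measure Ω} {X : ℝ≥0 → Ω → ℝ} {h : ℝ≥0}

theorem memLp_gridInterp (hX : ∀ t, MemLp (X t) 2 P) (h t : ℝ≥0) :
    MemLp (fun ω => gridInterp h (X · ω) t) 2 P := by
  simp only [gridInterp_eq_add, smul_eq_mul]
  exact ((hX _).const_mul _).add ((hX _).const_mul _)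

theorem covariance_gridInterp_left [IsFiniteMeasure P] (hX : ∀ t, MemLp (X t) 2 P) {Y : Ω → ℝ}
    (hY : MemLp Y 2 P) (h t : ℝ≥0) :
    cov[fun ω => gridInterp h (X · ω) t, Y; P] = gridInterp h (fun s => cov[X s, Y; P]) t := by
  simp only [gridInterp_eq_add, smul_eq_mul]
  refine (covariance_add_left ((hX _).const_mul _) ((hX _).const_mul _) hY).trans ?_
  rw [covariance_const_mul_left, covariance_const_mul_left]

theorem isGaussianProcess_sumElim_sub_gridInterp (hX : IsGaussianProcess X P) (h : ℝ≥0) :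
    IsGaussianProcess (Sum.elim (fun t ω => X t ω - gridInterp h (X · ω) t)
      fun (k : ℕ) ω => X (k * h) ω) P := by
  refine hX.of_isGaussianProcess ?_
  rintro (t | k)
  · let l : ℝ≥0 := ⌊t / h⌋₊ * h
    let r : ℝ≥0 := (⌊t / h⌋₊ + 1) * h
    let θ : ℝ := t / h - ⌊t / h⌋₊
    let coordAt (s : ℝ≥0) (hs : s ∈ ({t, l, r} : Finset ℝ≥0)) :=
      ContinuousLinearMap.proj (R := ℝ) (φ := fun _ : ({t, l, r} : Finset ℝ≥0) => ℝ) ⟨s, hs⟩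
    refine ⟨{t, l, r}, coordAt t (by simp)
      - ((1 - θ) • coordAt l (by simp) + θ • coordAt r (by simp)), fun ω => ?_⟩
    exact congrArg (X t ω - ·) (gridInterp_eq_add h (X · ω) t)
  · exact ⟨{k * h}, ContinuousLinearMap.proj ⟨k * h, Finset.mem_singleton_self _⟩, fun ω => rfl⟩

/- The covariance `s ↦ min s (k h)` of Brownian motion with its value at a grid point is affine on
every cell of the grid, hence equal to its own interpolation. -/
theorem indepFun_sub_gridInterp (hX : IsPreBrownianReal X P) (hh : 0 < h) :
    IndepFun (fun ω t => X t ω - gridInterp h (X · ω) t) (fun ω (k : ℕ) => X (k * h) ω) P := by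
  have := hX.isGaussianProcess.isProbabilityMeasure
  have hX2 (t : ℝ≥0) : MemLp (X t) 2 P := (hX.isGaussianProcess.hasGaussianLaw_eval t).memLp_two
  refine (isGaussianProcess_sumElim_sub_gridInterp hX.isGaussianProcess
    h).indepFun_of_covariance_eq_zero
    (fun t => (hX.aemeasurable t).sub (memLp_gridInterp hX2 h t).aemeasurable)
    (fun k => hX.aemeasurable _) fun t k => ?_
  rw [covariance_fun_sub_left (hX2 t) (memLp_gridInterp hX2 h t) (hX2 _),
    covariance_gridInterp_left hX2 (hX2 _)]
  simp only [hX.covariance_eval, NNReal.coe_min, NNReal.coe_mul, NNReal.coe_natCast,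
    gridInterp_min hh, sub_self]

theorem measure_iInter_increment_preimage_pos (hX : IsPreBrownianReal X P) {t : ℕ → ℝ≥0}
    (ht : StrictMono t) {O : ℕ → Set ℝ} (hO : ∀ k, IsOpen (O k)) (hne : ∀ k, (O k).Nonempty)
    (N : ℕ) : 0 < P (⋂ k ∈ Finset.range N, (fun ω => X (t (k + 1)) ω - X (t k) ω) ⁻¹' O k) := by
  have := hX.isGaussianProcess.isProbabilityMeasure
  rw [(hX.hasIndepIncrements.nat ht.monotone).measure_inter_preimage_eq_mul _
    fun k _ => (hO k).measurableSet, pos_iff_ne_zero, Finset.prod_ne_zero_iff]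
  intro k _ hk
  have hlaw := hX.hasLaw_sub (t (k + 1)) (t k)
  have hvar : nndist (t (k + 1)).1 (t k).1 ≠ 0 := by
    rw [Ne, nndist_eq_zero]
    exact fun heq => (ht k.lt_succ_self).ne' (NNReal.coe_injective heq)
  have hgauss : gaussianReal 0 (nndist (t (k + 1)).1 (t k).1) (O k) = 0 := by
    rw [← hlaw.map_eq, Measure.map_apply_of_aemeasurable hlaw.aemeasurable (hO k).measurableSet]
    exact hk
  exact ((hO k).measure_pos volume (hne k)).ne' (gaussianReal_absolutelyContinuous' 0 hvar hgauss)

theorem dist_le_mul_of_dist_sub_le {E : Type*} [SeminormedAddCommGroup E] {u c : ℕ → E}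
    (h₀ : u 0 = c 0) {N : ℕ} {e : ℝ}
    (h : ∀ k < N, dist (u (k + 1) - u k) (c (k + 1) - c k) ≤ e) {k : ℕ} (hk : k ≤ N) :
    dist (u k) (c k) ≤ k * e := by
  have hsum := dist_le_range_sum_of_dist_le (f := fun i => u i - c i) (d := fun _ => e) k
    fun {i} hi => by
      rw [dist_comm, dist_eq_norm, sub_sub_sub_comm, ← dist_eq_norm]
      exact h i (hi.trans_le hk)
  rwa [h₀, sub_self, dist_zero_left, ← dist_eq_norm, Finset.sum_const, Finset.card_range,
    nsmul_eq_mul] at hsum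

theorem measure_preimage_pi_Iic_closedBall_pos (hX : IsPreBrownianReal X P) {t : ℕ → ℝ≥0}
    (ht : StrictMono t) (ht₀ : t 0 = 0) {c : ℕ → ℝ} (hc₀ : c 0 = 0) (N : ℕ) {ε : ℝ} (hε : 0 < ε) :
    0 < P ((fun ω k => X (t k) ω) ⁻¹' (Set.Iic N).pi fun k => Metric.closedBall (c k) ε) := by
  have he : 0 < ε / (N + 1) := by positivity
  refine (measure_iInter_increment_preimage_pos hX ht
    (O := fun k => Metric.ball (c (k + 1) - c k) (ε / (N + 1))) (fun k => Metric.isOpen_ball)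
    (fun k => Metric.nonempty_ball.2 he) N).trans_le (measure_mono_ae ?_)
  filter_upwards [hX.eval_zero_ae_eq_zero] with ω hω₀ hω k hk
  have hincr (i : ℕ) (hi : i < N) :
      dist (X (t (i + 1)) ω - X (t i) ω) (c (i + 1) - c i) ≤ ε / (N + 1) :=
    (Metric.mem_ball.1 (Set.mem_iInter₂.1 hω i (Finset.mem_range.2 hi))).le
  refine (dist_le_mul_of_dist_sub_le (u := fun k => X (t k) ω) (by rw [ht₀, hω₀, hc₀]) hincr
    hk).trans ?_
  have hkN : (k : ℝ) ≤ N + 1 := by exact_mod_cast (Set.mem_Iic.1 hk).trans N.le_succ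
  calc k * (ε / (N + 1)) ≤ (N + 1) * (ε / (N + 1)) := by gcongr
    _ = ε := mul_div_cancel₀ _ (by positivity)

theorem frequently_measure_pos_of_ae_eventually {α ι : Type*} [MeasurableSpace α] {μ : Measure α}
    [NeZero μ] {l : Filter ι} [l.NeBot] [l.IsCountablyGenerated] {p : α → ι → Prop}
    (h : ∀ᵐ x ∂μ, ∀ᶠ i in l, p x i) : ∃ᶠ i in l, 0 < μ {x | p x i} := by
  obtain ⟨u, hu⟩ := exists_seq_tendsto l
  intro hzero
  obtain ⟨N, hN⟩ := eventually_atTop.1 (hu.eventually hzero)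
  have hnot : ∀ᵐ x ∂μ, ∀ k ≥ N, ¬ p x (u k) :=
    ae_all_iff.2 fun k => ae_all_iff.2 fun hk => by
      rw [ae_iff]
      simpa only [not_not, not_lt, nonpos_iff_eq_zero] using hN k hk
  obtain ⟨x, hx, hnx⟩ := (h.and hnot).exists
  obtain ⟨k, hk, hNk⟩ := ((hu.eventually hx).and (eventually_ge_atTop N)).exists
  exact hnx k hNk hk

theorem measure_preimage_pi_closedBall_pos (hX : IsBrownianReal X P) {φ : ℝ≥0 → ℝ}
    (hφ : Continuous φ) (hφ₀ : φ 0 = 0) {D : Set ℝ≥0} (hD : D.Countable) {T : ℝ≥0}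
    (hDT : ∀ t ∈ D, t ≤ T) {ε : ℝ} (hε : 0 < ε) :
    0 < P ((fun ω t => X t ω) ⁻¹' D.pi fun t => Metric.closedBall (φ t) ε) := by
  have := hX.isGaussianProcess.isProbabilityMeasure
  have hε3 : 0 < ε / 3 := by positivity
  have hfreq : ∃ᶠ h in 𝓝[>] (0 : ℝ≥0), 0 < P ((fun ω t => X t ω - gridInterp h (X · ω) t) ⁻¹'
      D.pi fun _ => Metric.closedBall 0 (ε / 3)) := by
    refine frequently_measure_pos_of_ae_eventually ?_
    filter_upwards [hX.cont] with ω hω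
    filter_upwards [eventually_dist_gridInterp_le hω T hε3] with h hh t ht
    rw [mem_closedBall_zero_iff, ← dist_eq_norm, dist_comm]
    exact hh t (hDT t ht)
  obtain ⟨h, hpos, hφh, hh⟩ := (hfreq.and_eventually
    ((eventually_dist_gridInterp_le hφ T hε3).and self_mem_nhdsWithin)).exists
  have hh0 : 0 < h := hh
  have hgrid := measure_preimage_pi_Iic_closedBall_pos hX.toIsPreBrownianReal
    (t := fun k => k * h) (c := fun k => φ (k * h)) (fun i j hij => by dsimp only; gcongr)
    (by simp) (by simpa using hφ₀) (⌊T / h⌋₊ + 1) hε3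
  have hboth := ENNReal.mul_pos hpos.ne' hgrid.ne'
  rw [← (indepFun_sub_gridInterp hX.toIsPreBrownianReal hh0).measure_inter_preimage_eq_mul _ _
    (MeasurableSet.pi hD fun _ _ => measurableSet_closedBall)
    (MeasurableSet.pi (Set.to_countable (Set.Iic _)) fun _ _ => measurableSet_closedBall)] at hboth
  refine hboth.trans_le (measure_mono ?_)
  rintro ω ⟨hω, hωgrid⟩ t ht
  have hXI : dist (X t ω) (gridInterp h (X · ω) t) ≤ ε / 3 := by
    simpa only [mem_closedBall_zero_iff, ← dist_eq_norm] using hω t ht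
  have hII : dist (gridInterp h (X · ω) t) (gridInterp h φ t) ≤ ε / 3 :=
    dist_gridInterp_gridInterp_le
      (Nat.lt_succ_of_le (Nat.floor_le_floor (by gcongr; exact hDT t ht))) hωgrid
  rw [Metric.mem_closedBall]
  linarith [dist_triangle4 (X t ω) (gridInterp h (X · ω) t) (gridInterp h φ t) (φ t),
    hφh t (hDT t ht)]

end BrownianSupport

section PathSpace

variable {X Z : Type*} [TopologicalSpace X] [PseudoEMetricSpace Z]

theorem mapsTo_iff_exists_forall_le_infEDist {K D : Set X} (hK : IsCompact K) (hDK : D ⊆ K)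
    (hKD : K ⊆ closure D) {U : Set Z} (hU : IsOpen U) {f : X → Z} (hf : Continuous f) :
    Set.MapsTo f K U ↔ ∃ k : ℕ, ∀ t ∈ D, (k : ℝ≥0∞)⁻¹ ≤ Metric.infEDist (f t) Uᶜ := by
  have hmem (z : Z) : z ∈ U ↔ 0 < Metric.infEDist z Uᶜ := by
    rw [Metric.infEDist_pos_iff_notMem_closure, hU.isClosed_compl.closure_eq, Set.notMem_compl_iff]
  have hcont : Continuous fun t => Metric.infEDist (f t) Uᶜ := Metric.continuous_infEDist.comp hf
  refine ⟨fun hKU => ?_, fun ⟨k, hk⟩ t ht => ?_⟩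
  · rcases K.eq_empty_or_nonempty with rfl | hne
    · exact ⟨0, fun t ht => (hDK ht).elim⟩
    obtain ⟨t₀, ht₀, hmin⟩ := hK.exists_isMinOn hne hcont.continuousOn
    obtain ⟨k, hk⟩ := ENNReal.exists_inv_nat_lt ((hmem _).1 (hKU ht₀)).ne'
    exact ⟨k, fun t ht => hk.le.trans (hmin (hDK ht))⟩
  · have hclosure := closure_minimal (fun s hs => hk s hs)
      (isClosed_le continuous_const hcont) (hKD ht)
    exact (hmem _).2 ((ENNReal.inv_pos.2 (ENNReal.natCast_ne_top k)).trans_le hclosure)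

theorem measurable_of_measurable_eval [SecondCountableTopology X] [LocallyCompactSpace X]
    [SecondCountableTopology Z] [MeasurableSpace Z] [BorelSpace Z] [MeasurableSpace C(X, Z)]
    [BorelSpace C(X, Z)] {Ω : Type*} [MeasurableSpace Ω] {f : Ω → C(X, Z)}
    (hf : ∀ t, Measurable fun ω => f ω t) : Measurable f := by
  rw [BorelSpace.measurable_eq (α := C(X, Z)),
    borel_eq_generateFrom_of_subbasis ContinuousMap.compactOpen_eq]
  refine measurable_generateFrom ?_
  rintro _ ⟨K, hK, U, hU, rfl⟩
  obtain ⟨D, hD, hdense⟩ := TopologicalSpace.exists_countable_dense K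
  have hpre : f ⁻¹' {g | Set.MapsTo g K U}
      = ⋃ k : ℕ, ⋂ t ∈ D, {ω | (k : ℝ≥0∞)⁻¹ ≤ Metric.infEDist (f ω t) Uᶜ} := by
    ext ω
    simpa using mapsTo_iff_exists_forall_le_infEDist hK (Subtype.coe_image_subset K D)
      (Subtype.dense_iff.1 hdense) hU (f ω).continuous
  rw [hpre]
  exact .iUnion fun k => .biInter hD fun t _ =>
    measurableSet_le measurable_const (hf t).infEDist

theorem exists_forall_dist_le_imp_mem {E : Type*} [PseudoMetricSpace E] {φ : C(ℝ≥0, E)}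
    {V : Set C(ℝ≥0, E)} (hV : V ∈ 𝓝 φ) :
    ∃ (T : ℝ≥0) (ε : ℝ), 0 < ε ∧ ∀ f : C(ℝ≥0, E), (∀ t ≤ T, dist (f t) (φ t) ≤ ε) → f ∈ V := by
  obtain ⟨R, hR, hRV⟩ := UniformSpace.mem_nhds_iff.1 hV
  obtain ⟨K, S, hK, hS, hKS⟩ := (ContinuousMap.mem_compactConvergence_entourage_iff R).1 hR
  obtain ⟨T, hT⟩ := hK.bddAbove
  obtain ⟨ε, hε, hεS⟩ := Metric.mem_uniformity_dist.1 hS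
  refine ⟨T, ε / 2, half_pos hε, fun f hf => hRV (hKS fun t ht => hεS ?_)⟩
  rw [dist_comm]
  exact (hf t (hT ht)).trans_lt (half_lt_self hε)

variable {Ω E : Type*} [NormedAddCommGroup E] {W : ℝ≥0 → Ω → E}

open Classical in
/-- The trajectories of the process `W` as points of the path space `C(ℝ≥0, E)`; discontinuous
trajectories are replaced by `0`. -/
noncomputable def pathMap (W : ℝ≥0 → Ω → E) (ω : Ω) : C(ℝ≥0, E) :=
  if h : Continuous fun t => W t ω then ⟨fun t => W t ω, h⟩ else 0

theorem coe_pathMap {ω : Ω} (h : Continuous fun t => W t ω) : ⇑(pathMap W ω) = fun t => W t ω := by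
  rw [pathMap, dif_pos h, ContinuousMap.coe_mk]

theorem aemeasurable_pathMap [MeasurableSpace Ω] {P : Measure Ω} [SecondCountableTopology E]
    [MeasurableSpace E] [BorelSpace E] [MeasurableSpace C(ℝ≥0, E)] [BorelSpace C(ℝ≥0, E)]
    (hcont : ∀ᵐ ω ∂P, Continuous fun t => W t ω) (hW : ∀ t, AEMeasurable (W t) P) :
    AEMeasurable (pathMap W) P := by
  refine NullMeasurable.aemeasurable (measurable_of_measurable_eval fun t => ?_)
  refine ((hW t).congr ?_).nullMeasurable
  filter_upwards [hcont] with ω hω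
  rw [coe_pathMap hω]

end PathSpace

section WienerSupport

variable {Ω : Type*} [MeasurableSpace Ω] {P : Measure Ω} {n : ℕ} {W : ℝ≥0 → Ω → Vec n}

theorem IsWiener.ae_continuous (hW : IsWiener P W) : ∀ᵐ ω ∂P, Continuous fun t => W t ω := by
  filter_upwards [ae_all_iff.2 fun i => (hW.coord i).cont] with ω hω
  exact (PiLp.continuous_toLp 2 fun _ : Fin n => ℝ).comp (continuous_pi hω)

theorem IsWiener.aemeasurable (hW : IsWiener P W) (t : ℝ≥0) : AEMeasurable (W t) P :=
  (MeasurableEquiv.toLp 2 (Fin n → ℝ)).measurable.comp_aemeasurable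
    (aemeasurable_pi_lambda _ fun i => (hW.coord i).aemeasurable t)

theorem IsWiener.measure_forall_dist_apply_le_pos (hW : IsWiener P W) {φ : C(ℝ≥0, Vec n)}
    (hφ₀ : φ 0 = 0) (T : ℝ≥0) {ε : ℝ} (hε : 0 < ε) :
    0 < P {ω | ∀ t ≤ T, ∀ i, dist (pathMap W ω t i) (φ t i) ≤ ε} := by
  obtain ⟨D, hD, hdense⟩ := TopologicalSpace.exists_countable_dense ℝ≥0
  have hDT : (D ∩ Set.Iio (T + 1)).Countable := hD.mono Set.inter_subset_left
  have hpos : 0 < P (⋂ i ∈ Finset.univ, (fun ω t => W t ω i) ⁻¹'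
      (D ∩ Set.Iio (T + 1)).pi fun t => Metric.closedBall (φ t i) ε) := by
    rw [hW.indep.measure_inter_preimage_eq_mul _
      fun i _ => MeasurableSet.pi hDT fun _ _ => measurableSet_closedBall, pos_iff_ne_zero,
      Finset.prod_ne_zero_iff]
    exact fun i _ => (measure_preimage_pi_closedBall_pos (hW.coord i) (by fun_prop)
      (by rw [hφ₀, PiLp.zero_apply]) hDT (fun t ht => ht.2.le) hε).ne'
  refine hpos.trans_le (measure_mono_ae ?_)
  filter_upwards [hW.ae_continuous] with ω hcont hω t ht i
  rw [coe_pathMap hcont]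
  have hclosed : IsClosed {t | dist (W t ω i) (φ t i) ≤ ε} :=
    isClosed_le (by fun_prop) continuous_const
  refine closure_minimal (fun s hs => Set.mem_iInter₂.1 hω i (Finset.mem_univ i) s hs) hclosed ?_
  rw [Set.inter_comm]
  exact hdense.open_subset_closure_inter isOpen_Iio (ht.trans_lt (lt_add_one T))

theorem IsWiener.measure_pathMap_preimage_pos (hW : IsWiener P W) {φ : C(ℝ≥0, Vec n)}
    (hφ₀ : φ 0 = 0) {V : Set C(ℝ≥0, Vec n)} (hV : V ∈ 𝓝 φ) : 0 < P (pathMap W ⁻¹' V) := by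
  obtain ⟨T, ε, hε, hTV⟩ := exists_forall_dist_le_imp_mem hV
  obtain ⟨e, he, heε⟩ := Metric.uniformContinuous_iff_le.1
    (PiLp.uniformContinuous_toLp 2 fun _ : Fin n => ℝ) ε hε
  exact (hW.measure_forall_dist_apply_le_pos hφ₀ T he).trans_le
    (measure_mono fun ω hω => hTV _ fun t ht => heε ((dist_pi_le_iff he.le).2 (hω t ht)))

end WienerSupport

theorem lowerSemicontinuous_measure_preimage {Ω Q Z : Type*} [MeasurableSpace Ω]
    [TopologicalSpace Q] [FirstCountableTopology Q] [TopologicalSpace Z] (μ : Measure Ω)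
    {Y : Q → Ω → Z} (hY : ∀ ω, Continuous fun q => Y q ω) {U : Set Z} (hU : IsOpen U) :
    LowerSemicontinuous fun q => μ (Y q ⁻¹' U) := by
  intro q c hc
  obtain ⟨N, hN⟩ := (𝓝 q).exists_antitone_basis
  have hmono : Monotone fun k => {ω | ∀ p ∈ N k, Y p ω ∈ U} :=
    fun _ _ hkl _ hω p hp => hω p (hN.antitone hkl hp)
  have hcover : Y q ⁻¹' U ⊆ ⋃ k, {ω | ∀ p ∈ N k, Y p ω ∈ U} := fun ω hω =>
    Set.mem_iUnion.2 (hN.mem_iff.1 ((hY ω).continuousAt.preimage_mem_nhds (hU.mem_nhds hω)))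
  obtain ⟨k, hk⟩ := lt_iSup_iff.1
    (hc.trans_le ((measure_mono hcover).trans_eq hmono.measure_iUnion))
  filter_upwards [hN.mem k] with p hp
  exact hk.trans_le (measure_mono fun ω hω => hω p hp)

section Transition

variable {Ω : Type*} [MeasurableSpace Ω] {P : Measure Ω} {d n : ℕ} {W : ℝ≥0 → Ω → Vec n}
  {A : Vec d →L[ℝ] Vec d} {B : Vec n →L[ℝ] Vec d} {F : Vec d → Vec d}

theorem transition_apply (hW : IsWiener P W) (hF : ∃ K, LipschitzWith K F) (x : Vec d) (T : ℝ≥0)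
    {U : Set (Vec d)} (hU : MeasurableSet U) :
    transition P W A F B T x U = P ((fun ω => solution A F B x (pathMap W ω) T) ⁻¹' U) := by
  borelize C(ℝ≥0, Vec n)
  have hae : (fun ω => solution A F B x (fun t => W t ω) T)
      =ᵐ[P] fun ω => solution A F B x (pathMap W ω) T := by
    filter_upwards [hW.ae_continuous] with ω hω
    rw [coe_pathMap hω]
  rw [transition, Measure.map_congr hae, Measure.map_apply_of_aemeasurable _ hU]
  exact (continuous_solution_driving hF x T).measurable.comp_aemeasurable
    (aemeasurable_pathMap hW.ae_continuous hW.aemeasurable)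

theorem lowerSemicontinuous_transition (hW : IsWiener P W) (hF : ∃ K, LipschitzWith K F)
    {U : Set (Vec d)} (hU : IsOpen U) :
    LowerSemicontinuous fun p : Vec d × ℝ≥0 => transition P W A F B p.2 p.1 U := by
  simp only [transition_apply hW hF _ _ hU.measurableSet]
  exact lowerSemicontinuous_measure_preimage P (fun ω => (continuous_solution hF).comp
    (f := fun p : Vec d × ℝ≥0 => (p.1, pathMap W ω, p.2)) (by fun_prop)) hU

theorem transition_pos (hW : IsWiener P W) (hF : ∃ K, LipschitzWith K F) {x : Vec d} {T : ℝ≥0}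
    {U : Set (Vec d)} (hU : IsOpen U) {η : C(ℝ≥0, Vec n)} (hη₀ : η 0 = 0)
    (hηU : solution A F B x η T ∈ U) : 0 < transition P W A F B T x U := by
  rw [transition_apply hW hF x T hU.measurableSet]
  exact hW.measure_pathMap_preimage_pos hη₀
    ((continuous_solution_driving hF x T).continuousAt.preimage_mem_nhds (hU.mem_nhds hηU))

end Transition

end LangevinSDE

theorem mainTheorem5_general {Ω : Type*} [MeasurableSpace Ω] {P : Measure Ω} {d n : ℕ}
    {W : ℝ≥0 → Ω → LangevinSDE.Vec n} (hW : LangevinSDE.IsWiener P W)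
    {A : LangevinSDE.Vec d →L[ℝ] LangevinSDE.Vec d}
    {B : LangevinSDE.Vec n →L[ℝ] LangevinSDE.Vec d} {F : LangevinSDE.Vec d → LangevinSDE.Vec d}
    (hF : ∃ K : ℝ≥0, LipschitzWith K F) {m : ℕ} (hm : LangevinSDE.kalmanSpan A B m = ⊤) {a C : ℝ}
    (ha : 0 ≤ a) (hma : (m - 1 : ℕ) * a < 1) (hbound : ∀ x, ‖F x‖ ≤ C * (1 + ‖x‖) ^ a)
    {U : Set (LangevinSDE.Vec d)} (hU : IsOpen U) :
    (U.Nonempty → ∀ (x : LangevinSDE.Vec d) (T : ℝ≥0), 0 < T →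
      0 < LangevinSDE.transition P W A F B T x U) ∧
    LowerSemicontinuous (fun p : LangevinSDE.Vec d × ℝ≥0 =>
      LangevinSDE.transition P W A F B p.2 p.1 U) := by
  refine ⟨fun hne x T hT => ?_, LangevinSDE.lowerSemicontinuous_transition hW hF hU⟩
  obtain ⟨η, hη₀, hηU⟩ := LangevinSDE.exists_solution_mem hF hm ha hma hbound hU hne x hT
  exact LangevinSDE.transition_pos hW hF hU hη₀ hηU

theorem mainTheorem5 {Ω : Type*} [MeasurableSpace Ω] (P : Measure Ω) [IsProbabilityMeasure P]
    (d n : ℕ) (W : ℝ≥0 → Ω → LangevinSDE.Vec n) (hW : LangevinSDE.IsWiener P W)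
    (A : LangevinSDE.Vec d →L[ℝ] LangevinSDE.Vec d)
    (B : LangevinSDE.Vec n →L[ℝ] LangevinSDE.Vec d)
    (F : LangevinSDE.Vec d → LangevinSDE.Vec d)
    (hF_smooth : ContDiff ℝ (⊤ : ℕ∞) F) (hF_lip : ∃ K : ℝ≥0, LipschitzWith K F)
    (hK : LangevinSDE.KalmanCondition A B)
    (dstar : ℕ) (hdstar : LangevinSDE.kalmanSpan A B dstar = ⊤)
    (hG : LangevinSDE.GrowthCondition F dstar)
    (x₀ : LangevinSDE.Vec d) (δ : ℝ) (hδ : 0 < δ) :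
    (∀ (x : LangevinSDE.Vec d) (T : ℝ≥0), 0 < T →
      0 < LangevinSDE.transition P W A F B T x (Metric.ball x₀ δ)) ∧
    LowerSemicontinuous (fun p : LangevinSDE.Vec d × ℝ≥0 =>
      LangevinSDE.transition P W A F B p.2 p.1 (Metric.ball x₀ δ)) := by
  obtain ⟨a, C, ha, hma, hbound⟩ := hG.exists_norm_le
  exact (mainTheorem5_general hW hF_lip hdstar ha hma hbound Metric.isOpen_ball).imp_left
    fun h => h (Metric.nonempty_ball.2 hδ)
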